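/- Let $E$ be a set with a metric $e_1$, and let $X=\{X_t: t\in E\}$ be a real-valued stochastic process. Put $F(t,x)=P(X_t\le x)$ and $\tau_\alpha(t)=\inf\{x: F(t,x)\ge\alpha\}$ for $\alpha\in(0,1)$. For independent copies $X_1,X_2,\dots$ of $X$ let $$F_n(t,x)=\frac1n\sum_{i=1}^n 1_{\{X_i(t)\le x\}},\qquad \tau^n_\alpha(t)=\inf\{x: F_n(t,x)\ge\alpha\},\qquad W_n(t,\alpha)=\sqrt n\,\bigl(\tau^n_\alpha(t)-\tau_\alpha(t)\bigr).$$ Let $I=[a,b]$ with $0<a\le b<1$, with the usual distance $e_2$. For a closed subspace $M$ of $\ell_\infty(S)$ (the bounded real functions on $S$ with the sup-norm), processes $Z_n$ indexed by $S$ *satisfy the CLT in $M$ with Gaussian limit $Z$* if almost surely $Z_n\in M$ for all $n\ge1$, the Gaussian process $Z$ has a version that is a Borel measurable map into $M$ with Radon law, and $\mathbb E^*h(Z_n)\to\mathbb E\,h(Z)$ for every bounded continuous $h: M\to\mathbb R$, where $\mathbb E^*$ is the upper expectation and $Z$ on the right is that version. Let $C_{e_1}(E)$ be the set of continuous functions on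 $(E,e_1)$. Let $D_1([0,T])$ be the set of cadlag functions on $[0,T]$, and let $D_2(I)$ be the set of functions on $I$ that are left continuous on $(a,b]$ and have right limits on $[a,b)$. Let $C_{e_1}(E)\otimes D_2(I)$ be the space of all $f\in\ell_\infty(E\times I)$ with $f(\cdot,\alpha)\in C_{e_1}(E)$ for all $\alpha\in I$ and $f(t,\cdot)\in D_2(I)$ for all $t\in E$; define $D_1([0,T])\otimes D_2(I)\subset \ell_\infty([0,T]\times I)$ in the same way. **Theorem.** Assume that the processes $W_n$ satisfy the CLT in $\ell_\infty(E\times I)$ with Gaussian limit $W=\{W(t,\alpha):(t,\alpha)\in E\times I\}$, that the identity map on $E\times I$ is continuous from the $e_1\times e_2$ topology to the topology of the $L_2$ distance $d_W(p,q)=(\mathbb E(W(p)-W(q))^2)^{1/2}$, and that $\tau_\alpha(\cdot)$ is continuous on $(E,e_1)$ for every $\alpha\in I$. (i) Suppose that the copies $X_j$ have versions $X_j'$ (that is, $X_j'(t)=X_j(t)$ almost surely, for each $t\in E$ and each $j$) whose paths are almost surely continuous on $(E,e_1)$, and let $W_n'$ be built from the $X_j'$ as $W_n$ is from the $X_j$.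 If $(E,e_1)$ is separable, or if the $W_n'$ themselves satisfy the CLT in $\ell_\infty(E\times I)$ with limit $W$ (in particular if $X_j'=X_j$), then $C_{e_1}(E)\otimes D_2(I)$ is a closed subspace of $\ell_\infty(E\times I)$ and the $W_n'$ satisfy the CLT in it, with limit $W$. Moreover, for every fixed $\alpha\in I$, the processes $W_n'(\cdot,\alpha)$ satisfy the CLT with limit $W(\cdot,\alpha)$ in the space of bounded functions in $C_{e_1}(E)$ with the sup-norm. (ii) Suppose that $E=[0,T]$ with the usual distance, and that the $X_j$ have versions $X_j'$ with almost surely cadlag paths. Then $D_1([0,T])\otimes D_2(I)$ is a closed subspace of $\ell_\infty([0,T]\times I)$ and the processes $W_n'$ built from the $X_j'$ satisfy the CLT in it, with limit $W$. Moreover, for every fixed $\alpha\in I$, the processes $W_n'(\cdot,\alpha)$ satisfy the CLT with limit $W(\cdot,\alpha)$ in $D_1([0,T])$ with the sup-norm. -/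

import Mathlib

open MeasureTheory ProbabilityTheory Filter Topology
open scoped BoundedContinuousFunction ENNReal

noncomputable section

namespace QuantileCLT

/-- The Banach space `ℓ_∞(S)` of bounded real functions on the set `S`, with the sup-norm. -/
abbrev LInf (S : Type*) : Type _ := lp (fun _ : S => ℝ) ∞

/-! ### Convergence in law of possibly non-measurable maps -/

section Convergence

variable {S Ω Ω' : Type*} [MeasurableSpace Ω] [MeasurableSpace Ω']

/-- The upper expectation `E^* f` of a bounded, not necessarily measurable, function `f`:
the infimum of the expectations of the integrable measurable functions above `f`. -/
def upperExp (P : Measure Ω) (f : Ω → ℝ) : ℝ :=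
  sInf {r : ℝ | ∃ g : Ω → ℝ, Measurable g ∧ Integrable g P ∧ (∀ ω, f ω ≤ g ω) ∧ r = ∫ ω, g ω ∂P}

open Classical in
/-- The function `f` as an element of the subspace `M` of `ℓ_∞(S)`; the value is `0` if `f` does
not belong to `M`. It is used for processes whose paths are in `M` almost surely only. -/
def toElem (M : Submodule ℝ (LInf S)) (f : S → ℝ) : M :=
  if h : ∃ z : M, ((z : LInf S) : S → ℝ) = f then h.choose else 0

/-- The processes `(Wn n)`, `n ≥ 1`, satisfy the CLT in the subspace `M` of `ℓ_∞(S)` (with the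
sup-norm), with Gaussian limit process `W`: almost surely the paths of `Wn n` belong to `M`,
the process `W` is Gaussian and has a version `V` with values in `M` which is Borel measurable
with Radon (tight) law on `M`, and `E^* h(Wn n) → E h(V)` for every bounded continuous
`h : M → ℝ`. -/
structure CLTIn (M : Submodule ℝ (LInf S)) (P : Measure Ω) (Wn : ℕ → S → Ω → ℝ)
    (P' : Measure Ω') (W : S → Ω' → ℝ) : Prop where
  gaussian : IsGaussianProcess W P'
  mem : ∀ n, 1 ≤ n → ∀ᵐ ω ∂P, ∃ z : M, ((z : LInf S) : S → ℝ) = fun s => Wn n s ω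
  conv : ∃ V : Ω' → M,
    Measurable[_, borel M] V ∧
    (∀ ε : ℝ, 0 < ε → ∃ K : Set M, IsCompact K ∧ P' {ω | V ω ∉ K} ≤ ENNReal.ofReal ε) ∧
    (∀ s, (fun ω => (V ω : LInf S) s) =ᵐ[P'] W s) ∧
    ∀ h : M →ᵇ ℝ,
      Tendsto (fun n : ℕ => upperExp P (fun ω => h (toElem M (fun s => Wn n s ω)))) atTop
        (𝓝 (∫ ω, h (V ω) ∂P'))

/-- The `L_2` distance of the process `W`. -/
def dL2 (P' : Measure Ω') (W : S → Ω' → ℝ) (p q : S) : ℝ :=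
  Real.sqrt (∫ ω, (W p ω - W q ω) ^ 2 ∂P')

end Convergence

/-! ### Quantiles and empirical quantiles -/

section Quantiles

variable {E Ω Ω₀ : Type*} [MeasurableSpace Ω] [MeasurableSpace Ω₀]

/-- `F(t,x) = P(X_t ≤ x)`. -/
def distFun (P₀ : Measure Ω₀) (X : E → Ω₀ → ℝ) (t : E) (x : ℝ) : ℝ :=
  P₀.real {ω | X t ω ≤ x}

/-- `τ_α(t) = inf {x | F(t,x) ≥ α}`. -/
def quantile (P₀ : Measure Ω₀) (X : E → Ω₀ → ℝ) (α : ℝ) (t : E) : ℝ :=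
  sInf {x : ℝ | α ≤ distFun P₀ X t x}

/-- `F_n(t,x)`, the empirical distribution function of `Y_0(t), …, Y_{n-1}(t)`. -/
def empDistFun (Y : ℕ → E → Ω → ℝ) (n : ℕ) (t : E) (ω : Ω) (x : ℝ) : ℝ :=
  (n : ℝ)⁻¹ * ∑ i ∈ Finset.range n, Set.indicator (Set.Iic x) (fun _ => (1 : ℝ)) (Y i t ω)

/-- `τ^n_α(t) = inf {x | F_n(t,x) ≥ α}`. -/
def empQuantile (Y : ℕ → E → Ω → ℝ) (n : ℕ) (α : ℝ) (t : E) (ω : Ω) : ℝ :=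
  sInf {x : ℝ | α ≤ empDistFun Y n t ω x}

/-- The empirical quantile processes `W_n(t,α) = √n (τ^n_α(t) - τ_α(t))`, `t ∈ E`, `α ∈ [a,b]`,
built from the sequence `Y`, where `X` is the input process. -/
def quantileProcess (P₀ : Measure Ω₀) (X : E → Ω₀ → ℝ) (Y : ℕ → E → Ω → ℝ) (a b : ℝ)
    (n : ℕ) (p : E × Set.Icc a b) (ω : Ω) : ℝ :=
  Real.sqrt n * (empQuantile Y n (p.2 : ℝ) p.1 ω - quantile P₀ X (p.2 : ℝ) p.1)

/-- The processes `Y j`, `j ∈ ℕ`, are independent copies of the process `X`: the random functions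
`Y j : Ω → ℝ^E` are independent, each with the law of `X` on `ℝ^E` with its product σ-algebra. -/
structure IsIIDCopies (P₀ : Measure Ω₀) (X : E → Ω₀ → ℝ) (P : Measure Ω) (Y : ℕ → E → Ω → ℝ) :
    Prop where
  measurable_input : ∀ t, Measurable (X t)
  measurable : ∀ j t, Measurable (Y j t)
  indep : iIndepFun (fun j ω => (fun t => Y j t ω : E → ℝ)) P
  identDistrib : ∀ j, IdentDistrib (fun ω => (fun t => Y j t ω : E → ℝ)) (fun ω t => X t ω) P P₀

/-- `Y' j` is a version of `Y j` for every `j`: `Y' j t = Y j t` almost surely, for every `t`. -/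
def IsVersion (P : Measure Ω) (Y' Y : ℕ → E → Ω → ℝ) : Prop :=
  ∀ j t, Y' j t =ᵐ[P] Y j t

end Quantiles

/-! ### The function spaces -/

/-- `z` is cadlag: right continuous with left limits. (At the end points of an interval, where
there is nothing to the right, respectively to the left, the conditions hold trivially.) -/
def IsCadlag {J : Type*} [TopologicalSpace J] [Preorder J] (z : J → ℝ) : Prop :=
  ∀ t, ContinuousWithinAt z (Set.Ici t) t ∧ ∃ l, Tendsto z (𝓝[<] t) (𝓝 l)

/-- `z ∈ D_2([a,b])`: `z` is left continuous on `(a,b]` and has right limits on `[a,b)`. -/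
def IsLeftContRightLim {a b : ℝ} (z : Set.Icc a b → ℝ) : Prop :=
  (∀ α : Set.Icc a b, a < α → ContinuousWithinAt z (Set.Iic α) α) ∧
    ∀ α : Set.Icc a b, (α : ℝ) < b → ∃ l, Tendsto z (𝓝[>] α) (𝓝 l)

lemma IsCadlag.zero {J : Type*} [TopologicalSpace J] [Preorder J] :
    IsCadlag (0 : J → ℝ) :=
  fun _ => ⟨continuousWithinAt_const, 0, tendsto_const_nhds⟩

lemma IsCadlag.add {J : Type*} [TopologicalSpace J] [Preorder J] {z w : J → ℝ}
    (hz : IsCadlag z) (hw : IsCadlag w) : IsCadlag (z + w) := fun t => by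
  obtain ⟨l, hl⟩ := (hz t).2
  obtain ⟨m, hm⟩ := (hw t).2
  exact ⟨(hz t).1.add (hw t).1, l + m, hl.add hm⟩

lemma IsCadlag.smul {J : Type*} [TopologicalSpace J] [Preorder J] {z : J → ℝ}
    (hz : IsCadlag z) (c : ℝ) : IsCadlag (c • z) := fun t => by
  obtain ⟨l, hl⟩ := (hz t).2
  exact ⟨(hz t).1.const_smul c, c • l, hl.const_smul c⟩

lemma IsLeftContRightLim.zero {a b : ℝ} : IsLeftContRightLim (0 : Set.Icc a b → ℝ) :=
  ⟨fun _ _ => continuousWithinAt_const, fun _ _ => ⟨0, tendsto_const_nhds⟩⟩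

lemma IsLeftContRightLim.add {a b : ℝ} {z w : Set.Icc a b → ℝ}
    (hz : IsLeftContRightLim z) (hw : IsLeftContRightLim w) : IsLeftContRightLim (z + w) := by
  refine ⟨fun α h => (hz.1 α h).add (hw.1 α h), fun α h => ?_⟩
  obtain ⟨l, hl⟩ := hz.2 α h
  obtain ⟨m, hm⟩ := hw.2 α h
  exact ⟨l + m, hl.add hm⟩

lemma IsLeftContRightLim.smul {a b : ℝ} {z : Set.Icc a b → ℝ}
    (hz : IsLeftContRightLim z) (c : ℝ) : IsLeftContRightLim (c • z) := by
  refine ⟨fun α h => (hz.1 α h).const_smul c, fun α h => ?_⟩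
  obtain ⟨l, hl⟩ := hz.2 α h
  exact ⟨c • l, hl.const_smul c⟩

/-- `C(E)` as a subspace of `ℓ_∞(E)`: the bounded continuous functions. -/
def spaceC (E : Type*) [TopologicalSpace E] : Submodule ℝ (LInf E) where
  carrier := {z | Continuous (z : E → ℝ)}
  zero_mem' := by
    simp only [Set.mem_ofPred_eq, lp.coeFn_zero]
    exact continuous_const
  add_mem' := fun hz hw => by
    simp only [Set.mem_ofPred_eq, lp.coeFn_add] at *
    exact hz.add hw
  smul_mem' := fun c z hz => by
    simp only [Set.mem_ofPred_eq, lp.coeFn_smul] at *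
    exact hz.const_smul c

/-- `D_1(J)` as a subspace of `ℓ_∞(J)`: the bounded cadlag functions (on `J = [0,T]`, every
cadlag function is bounded). -/
def spaceD (J : Type*) [TopologicalSpace J] [Preorder J] : Submodule ℝ (LInf J) where
  carrier := {z | IsCadlag (z : J → ℝ)}
  zero_mem' := by
    simp only [Set.mem_ofPred_eq, lp.coeFn_zero]
    exact IsCadlag.zero
  add_mem' := fun hz hw => by
    simp only [Set.mem_ofPred_eq, lp.coeFn_add] at *
    exact hz.add hw
  smul_mem' := fun c z hz => by
    simp only [Set.mem_ofPred_eq, lp.coeFn_smul] at *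
    exact hz.smul c

/-- `C(E) ⊗ D_2([a,b])`: the `f ∈ ℓ_∞(E × [a,b])` with `f(·,α) ∈ C(E)` for all `α` and
`f(t,·) ∈ D_2([a,b])` for all `t`. -/
def spaceCD (E : Type*) [TopologicalSpace E] (a b : ℝ) :
    Submodule ℝ (LInf (E × Set.Icc a b)) where
  carrier := {z | (∀ α : Set.Icc a b, Continuous (fun t : E => z (t, α))) ∧
    ∀ t : E, IsLeftContRightLim (fun α : Set.Icc a b => z (t, α))}
  zero_mem' := by
    simp only [Set.mem_ofPred_eq, lp.coeFn_zero]
    exact ⟨fun _ => continuous_const, fun _ => IsLeftContRightLim.zero⟩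
  add_mem' := fun hz hw => by
    simp only [Set.mem_ofPred_eq, lp.coeFn_add] at *
    exact ⟨fun α => (hz.1 α).add (hw.1 α), fun t => (hz.2 t).add (hw.2 t)⟩
  smul_mem' := fun c z hz => by
    simp only [Set.mem_ofPred_eq, lp.coeFn_smul] at *
    exact ⟨fun α => (hz.1 α).const_smul c, fun t => (hz.2 t).smul c⟩

/-- `D_1(J) ⊗ D_2([a,b])`: the `f ∈ ℓ_∞(J × [a,b])` with `f(·,α) ∈ D_1(J)` for all `α` and
`f(t,·) ∈ D_2([a,b])` for all `t`. -/
def spaceDD (J : Type*) [TopologicalSpace J] [Preorder J] (a b : ℝ) :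
    Submodule ℝ (LInf (J × Set.Icc a b)) where
  carrier := {z | (∀ α : Set.Icc a b, IsCadlag (fun t : J => z (t, α))) ∧
    ∀ t : J, IsLeftContRightLim (fun α : Set.Icc a b => z (t, α))}
  zero_mem' := by
    simp only [Set.mem_ofPred_eq, lp.coeFn_zero]
    exact ⟨fun _ => IsCadlag.zero, fun _ => IsLeftContRightLim.zero⟩
  add_mem' := fun hz hw => by
    simp only [Set.mem_ofPred_eq, lp.coeFn_add] at *
    exact ⟨fun α => (hz.1 α).add (hw.1 α), fun t => (hz.2 t).add (hw.2 t)⟩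
  smul_mem' := fun c z hz => by
    simp only [Set.mem_ofPred_eq, lp.coeFn_smul] at *
    exact ⟨fun α => (hz.1 α).smul c, fun t => (hz.2 t).smul c⟩

/-! ### The standing hypotheses -/

/-- The hypotheses common to both parts, for the input process `X` with index set `E`, its i.i.d.
copies `Y j`, the interval `[a,b]` and the limit process `W`. The field `id_continuous` says that
the identity map of `E × [a,b]` is continuous from the product topology to the topology of the
`L_2` distance of `W`. -/
structure Hyp {E Ω₀ Ω Ω' : Type*} [MeasurableSpace Ω₀] [MeasurableSpace Ω] [MeasurableSpace Ω']
    [MetricSpace E] (P₀ : Measure Ω₀) (X : E → Ω₀ → ℝ) (P : Measure Ω) (Y : ℕ → E → Ω → ℝ)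
    (a b : ℝ) (P' : Measure Ω') (W : E × Set.Icc a b → Ω' → ℝ) : Prop where
  copies : IsIIDCopies P₀ X P Y
  clt : CLTIn (⊤ : Submodule ℝ (LInf (E × Set.Icc a b))) P (quantileProcess P₀ X Y a b) P' W
  id_continuous : ∀ p : E × Set.Icc a b, Tendsto (fun q => dL2 P' W q p) (𝓝 p) (𝓝 0)
  quantile_continuous : ∀ α ∈ Set.Icc a b, Continuous (fun t : E => quantile P₀ X α t)

end QuantileCLT

end

namespace QuantileCLT

/-! ### CLTs in subspaces of `ℓ_∞(S)`: restriction, transfer, and the support of the limit. -/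

section Abstract

variable {S S' Ω Ω' : Type*} [MeasurableSpace Ω] [MeasurableSpace Ω']

/-! Three facts bring the CLT from `ℓ_∞(E × I)` down to the subspace `M` of functions that are
regular in each variable. The limit lies in `M` (`ae_mem_of_L2_continuous`). By tightness, its law
is nearly carried by finitely many balls of radius `ε`. The mean of the limit conditioned on such a
ball stays within `ε` of the centre, and `L_2` continuity makes it a continuous function. The limit
is thus almost surely in the closure of the bounded continuous functions, which are contained in the
closed space `M`. The paths lie in `M`: at fixed `α` an empirical quantile is 1-Lipschitz in the
data for the sup-norm (`sInf_empCDF_sub_le`), so limits in `t` pass from the `X_j'` to `W_n'`; in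
`α`, quantile functions are left continuous with right limits. Versions do not matter
(`CLTIn.transfer`). For a suitable set `D`, the processes agree almost surely on `D × I`, and
restriction to `D × I` is isometric on `M`. By Tietze, a test function on `M` is the restriction of
one on `ℓ_∞(D × I)`, which can be evaluated on `W_n` as well. In the separable and cadlag cases `D`
is countable and dense, so that null sets can be united. The statements for fixed `α` follow by
continuous mapping. -/

lemma LInf.abs_apply_le (z : LInf S) (s : S) : |z s| ≤ ‖z‖ :=
  lp.norm_apply_le_norm ENNReal.top_ne_zero z s

lemma LInf.abs_sub_apply_le (z w : LInf S) (s : S) : |z s - w s| ≤ ‖z - w‖ :=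
  LInf.abs_apply_le (z - w) s

lemma memℓp_of_abs_le {f : S → ℝ} {C : ℝ} (h : ∀ s, |f s| ≤ C) : Memℓp f ∞ :=
  memℓp_infty ⟨C, by rintro _ ⟨s, rfl⟩; exact h s⟩

lemma exists_mem_of_abs_le {M : Submodule ℝ (LInf S)} {f : S → ℝ} {C : ℝ} (h : ∀ s, |f s| ≤ C)
    (hM : ∀ z : LInf S, (z : S → ℝ) = f → z ∈ M) :
    ∃ z : M, ((z : LInf S) : S → ℝ) = f :=
  ⟨⟨⟨f, memℓp_of_abs_le h⟩, hM _ rfl⟩, rfl⟩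

/-- The restriction `z ∘ g` of the bounded function `z` along `g`. -/
def pullback (g : S' → S) (z : LInf S) : LInf S' :=
  ⟨fun s => z (g s), memℓp_of_abs_le fun s => LInf.abs_apply_le z (g s)⟩

lemma norm_pullback_le (g : S' → S) (z : LInf S) : ‖pullback g z‖ ≤ ‖z‖ :=
  lp.norm_le_of_forall_le (norm_nonneg _) fun s => LInf.abs_apply_le z (g s)

lemma pullback_sub (g : S' → S) (z w : LInf S) :
    pullback g (z - w) = pullback g z - pullback g w := rfl

lemma continuous_pullback (g : S' → S) : Continuous (pullback g) := by
  refine (LipschitzWith.of_dist_le_mul (K := 1) fun z w => ?_).continuous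
  rw [dist_eq_norm, dist_eq_norm, ← pullback_sub, NNReal.coe_one, one_mul]
  exact norm_pullback_le g _

lemma toElem_of_eq {M : Submodule ℝ (LInf S)} {f : S → ℝ} {z : M}
    (h : ((z : LInf S) : S → ℝ) = f) : toElem M f = z := by
  have hex : ∃ z : M, ((z : LInf S) : S → ℝ) = f := ⟨z, h⟩
  rw [toElem, dif_pos hex]
  exact Subtype.ext (lp.ext (hex.choose_spec.trans h.symm))

/-- The set where `f` and `g` differ need not be measurable, so it is enlarged to a measurable null
set, on which a majorant of `g` is replaced by the bound `C` of `f`. -/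
lemma upperExp_bounds_subset_of_ae_eq {P : Measure Ω} [IsFiniteMeasure P] {f g : Ω → ℝ} {C : ℝ}
    (hf : ∀ ω, |f ω| ≤ C) (h : f =ᵐ[P] g) :
    {r : ℝ | ∃ k : Ω → ℝ, Measurable k ∧ Integrable k P ∧ (∀ ω, g ω ≤ k ω) ∧
      r = ∫ ω, k ω ∂P} ⊆
    {r : ℝ | ∃ k : Ω → ℝ, Measurable k ∧ Integrable k P ∧ (∀ ω, f ω ≤ k ω) ∧
      r = ∫ ω, k ω ∂P} := by
  classical
  rintro r ⟨k, hk, hki, hgk, rfl⟩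
  obtain ⟨N, hN, hNm, hN0⟩ := exists_measurable_superset_of_null (ae_iff.1 h)
  have hae : N.piecewise (fun _ => C) k =ᵐ[P] k := by
    filter_upwards [measure_eq_zero_iff_ae_notMem.1 hN0] with ω hω
    exact Set.piecewise_eq_of_notMem _ _ _ hω
  refine ⟨N.piecewise (fun _ => C) k, measurable_const.piecewise hNm hk, hki.congr hae.symm,
    fun ω => ?_, (integral_congr_ae hae).symm⟩
  by_cases hω : ω ∈ N
  · rw [Set.piecewise_eq_of_mem _ _ _ hω]
    exact (le_abs_self _).trans (hf ω)
  · rw [Set.piecewise_eq_of_notMem _ _ _ hω]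
    have : f ω = g ω := by
      by_contra hne
      exact hω (hN hne)
    exact this.trans_le (hgk ω)

lemma upperExp_congr {P : Measure Ω} [IsFiniteMeasure P] {f g : Ω → ℝ} {C D : ℝ}
    (hf : ∀ ω, |f ω| ≤ C) (hg : ∀ ω, |g ω| ≤ D) (h : f =ᵐ[P] g) : upperExp P f = upperExp P g :=
  congrArg sInf ((upperExp_bounds_subset_of_ae_eq hg h.symm).antisymm (upperExp_bounds_subset_of_ae_eq hf h))

/-- Continuous mapping theorem for restrictions. -/
lemma CLTIn.pullback {M : Submodule ℝ (LInf S)} {N : Submodule ℝ (LInf S')} {P : Measure Ω}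
    [IsFiniteMeasure P] {Z : ℕ → S → Ω → ℝ} {P' : Measure Ω'} {W : S → Ω' → ℝ}
    (h : CLTIn M P Z P' W) (g : S' → S) (hg : ∀ z ∈ M, QuantileCLT.pullback g z ∈ N) :
    CLTIn N P (fun n s ω => Z n (g s) ω) P' (fun s => W (g s)) := by
  obtain ⟨V, hVm, hVt, hVW, hVc⟩ := h.conv
  let L : M → N := fun z => ⟨QuantileCLT.pullback g z, hg z z.2⟩
  have hL : Continuous L := ((continuous_pullback g).comp continuous_subtype_val).subtype_mk _
  refine ⟨h.gaussian.comp_right g, fun n hn => ?_, fun ω => L (V ω), ?_, fun ε hε => ?_,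
    fun s => hVW (g s), fun k => ?_⟩
  · filter_upwards [h.mem n hn] with ω ⟨z, hz⟩
    exact ⟨L z, funext fun s => congrFun hz (g s)⟩
  · exact (hL.borel_measurable).comp hVm
  · obtain ⟨K, hK, hKε⟩ := hVt ε hε
    exact ⟨L '' K, hK.image hL,
      (measure_mono fun ω (hω : L (V ω) ∉ L '' K) hV => hω (Set.mem_image_of_mem L hV)).trans hKε⟩
  · refine (hVc (k.compContinuous ⟨L, hL⟩)).congr' ?_
    filter_upwards [eventually_ge_atTop 1] with n hn
    refine upperExp_congr (C := ‖k‖) (D := ‖k‖) (fun ω => k.norm_coe_le_norm _)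
      (fun ω => k.norm_coe_le_norm _) ?_
    filter_upwards [h.mem n hn] with ω ⟨z, hz⟩
    rw [toElem_of_eq hz, toElem_of_eq (M := N) (z := L z) (funext fun s => congrFun hz (g s))]
    rfl

/-- If the limit of a CLT in `ℓ_∞(S)` lives in a closed subspace `M`, whose norm is determined by
the values along `g`, then processes with paths in `M` which agree along `g` with the given ones
satisfy the CLT in `M`. -/
lemma CLTIn.transfer {M : Submodule ℝ (LInf S)} (hM : IsClosed (M : Set (LInf S)))
    {P : Measure Ω} [IsFiniteMeasure P] {Z Z' : ℕ → S → Ω → ℝ} {P' : Measure Ω'}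
    {W : S → Ω' → ℝ} (h : CLTIn (⊤ : Submodule ℝ (LInf S)) P Z P' W) (g : S' → S)
    (hg : ∀ z ∈ M, ‖z‖ ≤ ‖QuantileCLT.pullback g z‖)
    (hZ : ∀ n, 1 ≤ n → ∀ᵐ ω ∂P, ∀ s, Z' n (g s) ω = Z n (g s) ω)
    (hZM : ∀ n, 1 ≤ n → ∀ᵐ ω ∂P, ∃ z : M, ((z : LInf S) : S → ℝ) = fun s => Z' n s ω)
    (hVM : ∀ V : Ω' → LInf S, Measurable[_, borel (LInf S)] V →
      (∀ ε : ℝ, 0 < ε → ∃ K : Set (LInf S), IsCompact K ∧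
        P' {ω | V ω ∉ K} ≤ ENNReal.ofReal ε) →
      (∀ s, (fun ω => V ω s) =ᵐ[P'] W s) → ∀ᵐ ω ∂P', V ω ∈ M) :
    CLTIn M P Z' P' W := by
  classical
  obtain ⟨V₀, hVm₀, hVt₀, hVW, hVc⟩ := h.conv
  have hval : Continuous ((↑) : (⊤ : Submodule ℝ (LInf S)) → LInf S) := continuous_subtype_val
  let V : Ω' → LInf S := fun ω => V₀ ω
  have hVm : Measurable[_, borel (LInf S)] V := hval.borel_measurable.comp hVm₀
  have hVt : ∀ ε : ℝ, 0 < ε → ∃ K : Set (LInf S), IsCompact K ∧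
      P' {ω | V ω ∉ K} ≤ ENNReal.ofReal ε := fun ε hε => by
    obtain ⟨K, hK, hKε⟩ := hVt₀ ε hε
    exact ⟨_, hK.image hval,
      (measure_mono fun ω (hω : V ω ∉ Subtype.val '' K) hV =>
        hω (Set.mem_image_of_mem _ hV)).trans hKε⟩
  have hV := hVM V hVm hVt hVW
  -- The limit is reset to `0` on the null event that it leaves `M`, so that it takes values in `M`
  -- everywhere.
  let U : Ω' → M := fun ω => if hω : V ω ∈ M then ⟨V ω, hω⟩ else 0
  have hU : ∀ ω, V ω ∈ M → ((U ω : M) : LInf S) = V ω := fun ω hω => by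
    simp only [U, dif_pos hω]
  have hemb : IsClosedEmbedding ((↑) : M → LInf S) := hM.isClosedEmbedding_subtypeVal
  refine ⟨h.gaussian, hZM, U, ?_, fun ε hε => ?_, fun s => ?_, fun k => ?_⟩
  · let _ : MeasurableSpace (LInf S) := borel _
    have _ : BorelSpace (LInf S) := ⟨rfl⟩
    let _ : MeasurableSpace M := borel _
    have _ : BorelSpace M := ⟨rfl⟩
    rw [← hemb.measurableEmbedding.measurable_comp_iff]
    have : (fun ω => ((U ω : M) : LInf S)) =
        Set.piecewise (V ⁻¹' (M : Set (LInf S))) V (fun _ => 0) := by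
      funext ω
      by_cases hω : V ω ∈ M
      · rw [hU ω hω, Set.piecewise_eq_of_mem (V ⁻¹' (M : Set (LInf S))) _ _ hω]
      · rw [Set.piecewise_eq_of_notMem (V ⁻¹' (M : Set (LInf S))) _ _ hω]
        simp only [U, dif_neg hω, ZeroMemClass.coe_zero]
    change Measurable (fun ω => ((U ω : M) : LInf S))
    rw [this]
    exact Measurable.piecewise (hVm hM.measurableSet) hVm measurable_const
  · obtain ⟨K, hK, hKε⟩ := hVt ε hε
    refine ⟨(↑) ⁻¹' K, hemb.isCompact_preimage hK, le_trans ?_ hKε⟩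
    refine measure_mono_ae ?_
    filter_upwards [hV] with ω hω hUK hVK
    refine hUK ?_
    change ((U ω : M) : LInf S) ∈ K
    rwa [hU ω hω]
  · filter_upwards [hVW s, hV] with ω hω hωM
    rw [hU ω hωM]
    exact hω
  -- Restriction along `g` is isometric on `M`; as `M` is complete its range is closed, and Tietze
  -- extends `k` to a bounded continuous `H` with `H ∘ r = k`.
  · let r : M → LInf S' := fun z => QuantileCLT.pullback g z
    have hr : Isometry r := by
      refine Isometry.of_dist_eq fun z w => ?_
      rw [dist_eq_norm, dist_eq_norm]
      exact (norm_pullback_le g ((z - w : M) : LInf S)).antisymm (hg _ (z - w).2)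
    have _ : CompleteSpace M := hM.completeSpace_coe
    obtain ⟨H, -, hH⟩ := BoundedContinuousFunction.exists_extension_norm_eq_of_isClosedEmbedding k
      hr.isClosedEmbedding
    have hH' : ∀ z : M, H (QuantileCLT.pullback g z) = k z := fun z => congrFun hH z
    have key := hVc (H.compContinuous ⟨fun z => QuantileCLT.pullback g z,
      (continuous_pullback g).comp hval⟩)
    have hint : ∫ ω, H (QuantileCLT.pullback g (V₀ ω)) ∂P' = ∫ ω, k (U ω) ∂P' := by
      refine integral_congr_ae ?_
      filter_upwards [hV] with ω hω
      rw [← hH', hU ω hω]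
    rw [← hint]
    refine key.congr' ?_
    filter_upwards [eventually_ge_atTop 1] with n hn
    refine upperExp_congr (C := ‖H‖) (D := ‖k‖) (fun ω => H.norm_coe_le_norm _)
      (fun ω => k.norm_coe_le_norm _) ?_
    filter_upwards [h.mem n hn, hZM n hn, hZ n hn] with ω ⟨z, hz⟩ ⟨z', hz'⟩ hω
    rw [toElem_of_eq hz, toElem_of_eq hz', ← hH']
    change H (QuantileCLT.pullback g z) = _
    congr 1
    refine lp.ext (funext fun s => ?_)
    change ((z : LInf S) : S → ℝ) (g s) = ((z' : LInf S) : S → ℝ) (g s)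
    rw [hz, hz']
    exact (hω s).symm

/-- This is nonnegativity of the variance of `|f|`. -/
lemma integral_abs_le_sqrt {P' : Measure Ω'} [IsProbabilityMeasure P'] {f : Ω' → ℝ}
    (hf : MemLp f 2 P') : ∫ ω, |f ω| ∂P' ≤ Real.sqrt (∫ ω, f ω ^ 2 ∂P') := by
  refine Real.le_sqrt_of_sq_le ?_
  have h0 := variance_nonneg (fun ω => |f ω|) P'
  rw [variance_eq_sub (by simpa using hf.norm)] at h0
  simpa using h0

/-- A tight version of an `L_2`-continuous Gaussian process has paths in every closed subspace
which contains the bounded continuous functions. -/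
lemma ae_mem_of_L2_continuous [TopologicalSpace S] {P' : Measure Ω'} [IsProbabilityMeasure P']
    {W : S → Ω' → ℝ} (hW : IsGaussianProcess W P')
    (hd : ∀ p : S, Tendsto (fun q => dL2 P' W q p) (𝓝 p) (𝓝 0))
    {M : Submodule ℝ (LInf S)} (hM : IsClosed (M : Set (LInf S)))
    (hC : ∀ z : LInf S, Continuous (z : S → ℝ) → z ∈ M)
    (V : Ω' → LInf S) (hVm : Measurable[_, borel (LInf S)] V)
    (hVt : ∀ ε : ℝ, 0 < ε → ∃ K : Set (LInf S), IsCompact K ∧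
      P' {ω | V ω ∉ K} ≤ ENNReal.ofReal ε)
    (hVW : ∀ s, (fun ω => V ω s) =ᵐ[P'] W s) : ∀ᵐ ω ∂P', V ω ∈ M := by
  have hW2 : ∀ s, MemLp (W s) 2 P' := fun s => (hW.hasGaussianLaw_eval s).memLp_two
  have hVi : ∀ s, Integrable (fun ω => V ω s) P' := fun s =>
    ((hW2 s).integrable one_le_two).congr (hVW s).symm
  have hball : ∀ (c : LInf S) (ε : ℝ), 0 < ε →
      ∀ᵐ ω ∂P', V ω ∈ Metric.closedBall c ε → ∃ f ∈ M, dist (V ω) f ≤ 2 * ε := by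
    intro c ε hε
    let _ : MeasurableSpace (LInf S) := borel _
    have _ : BorelSpace (LInf S) := ⟨rfl⟩
    set A : Set Ω' := V ⁻¹' Metric.closedBall c ε with hA
    have hAm : MeasurableSet A := hVm Metric.isClosed_closedBall.measurableSet
    by_cases h0 : P' A = 0
    · filter_upwards [measure_eq_zero_iff_ae_notMem.1 h0] with ω hω hω'
      exact absurd hω' hω
    have hm : 0 < P'.real A := ENNReal.toReal_pos h0 (measure_ne_top _ _)
    -- The conditional mean of `V` given that it falls in the ball, taken pointwise in `s`.
    let f : S → ℝ := fun s => (P'.real A)⁻¹ * ∫ ω in A, V ω s ∂P'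
    have hfc : ∀ s, |f s - c s| ≤ ε := fun s => by
      have h1 : f s - c s = (P'.real A)⁻¹ * ∫ ω in A, (V ω s - c s) ∂P' := by
        rw [integral_sub (hVi s).integrableOn (integrable_const _), setIntegral_const, smul_eq_mul,
          mul_sub, ← mul_assoc, inv_mul_cancel₀ hm.ne', one_mul]
      have h2 : ‖∫ ω in A, (V ω s - c s) ∂P'‖ ≤ ε * P'.real A := by
        refine norm_setIntegral_le_of_norm_le_const (measure_lt_top _ _) fun ω hω => ?_
        refine (LInf.abs_sub_apply_le (V ω) c s).trans ?_
        rw [← dist_eq_norm]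
        exact hω
      rw [h1, abs_mul, abs_of_pos (inv_pos.2 hm)]
      rw [Real.norm_eq_abs] at h2
      calc (P'.real A)⁻¹ * |∫ ω in A, (V ω s - c s) ∂P'|
          ≤ (P'.real A)⁻¹ * (ε * P'.real A) := by gcongr
        _ = ε := by field_simp
    have hfb : ∀ s, |f s| ≤ ε + ‖c‖ := fun s => by
      have := abs_add_le (f s - c s) (c s)
      rw [sub_add_cancel] at this
      exact this.trans (add_le_add (hfc s) (LInf.abs_apply_le c s))
    let F : LInf S := ⟨f, memℓp_of_abs_le hfb⟩
    have hF : F ∈ M := by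
      -- The modulus of continuity is `d_W / P'(A)`, since the `L_1` distance of `W q` and `W p` is
      -- at most their `L_2` distance.
      refine hC F (continuous_iff_continuousAt.2 fun p => ?_)
      rw [ContinuousAt, tendsto_iff_dist_tendsto_zero]
      refine squeeze_zero (g := fun q => (P'.real A)⁻¹ * dL2 P' W q p) (fun _ => dist_nonneg)
        (fun q => ?_) (by simpa using (hd p).const_mul (P'.real A)⁻¹)
      change |f q - f p| ≤ _
      have h1 : f q - f p = (P'.real A)⁻¹ * ∫ ω in A, (V ω q - V ω p) ∂P' := by
        rw [integral_sub (hVi q).integrableOn (hVi p).integrableOn, mul_sub]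
      rw [h1, abs_mul, abs_of_pos (inv_pos.2 hm)]
      gcongr
      calc |∫ ω in A, (V ω q - V ω p) ∂P'| ≤ ∫ ω in A, |V ω q - V ω p| ∂P' :=
            abs_integral_le_integral_abs
        _ ≤ ∫ ω, |V ω q - V ω p| ∂P' :=
            setIntegral_le_integral ((hVi q).sub (hVi p)).abs (ae_of_all _ fun _ => abs_nonneg _)
        _ = ∫ ω, |W q ω - W p ω| ∂P' := by
            refine integral_congr_ae ?_
            filter_upwards [hVW q, hVW p] with ω h1 h2
            rw [h1, h2]
        _ ≤ dL2 P' W q p := integral_abs_le_sqrt ((hW2 q).sub (hW2 p))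
    refine ae_of_all _ fun ω hω => ⟨F, hF, ?_⟩
    have hcF : dist c F ≤ ε := by
      rw [dist_comm, dist_eq_norm]
      exact lp.norm_le_of_forall_le hε.le hfc
    linarith [dist_triangle (V ω) c F, Metric.mem_closedBall.1 hω]
  have hK : ∀ K : Set (LInf S), IsCompact K → ∀ᵐ ω ∂P', V ω ∈ K → V ω ∈ M := by
    intro K hK
    -- Finitely many balls of radius `1/(n+1)` cover `K`. Intersecting the almost sure events over
    -- `n` puts `V ω` at distance zero from the closed set `M`.
    have h1 : ∀ n : ℕ, ∀ᵐ ω ∂P', V ω ∈ K → ∃ f ∈ M, dist (V ω) f ≤ 2 * (1 / ((n : ℝ) + 1)) := by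
      intro n
      obtain ⟨t, -, ht, hKt⟩ := hK.finite_cover_balls (Nat.one_div_pos_of_nat (α := ℝ) (n := n))
      have := (ae_ball_iff ht.countable).2 fun c _ =>
        hball c _ (Nat.one_div_pos_of_nat (α := ℝ) (n := n))
      filter_upwards [this] with ω hω hωK
      obtain ⟨c, hc, hωc⟩ := Set.mem_iUnion₂.1 (hKt hωK)
      exact hω c hc (Metric.ball_subset_closedBall hωc)
    filter_upwards [ae_all_iff.2 h1] with ω hω hωK
    rw [← SetLike.mem_coe, ← hM.closure_eq, Metric.mem_closure_iff]
    intro ε hε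
    obtain ⟨n, hn⟩ := exists_nat_one_div_lt (half_pos hε)
    obtain ⟨f, hf, hfd⟩ := hω n hωK
    exact ⟨f, hf, by linarith⟩
  rw [ae_iff]
  refine le_antisymm (ENNReal.le_of_forall_pos_le_add fun ε hε _ => ?_) zero_le
  obtain ⟨K, hKc, hKε⟩ := hVt ε hε
  rw [zero_add]
  rw [ENNReal.ofReal_coe_nnreal] at hKε
  refine (measure_mono_ae ?_).trans hKε
  filter_upwards [hK K hKc] with ω hω hn hωK
  exact hn (hω hωK)

end Abstract

/-! ### Closedness of the function spaces -/

section Spaces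

/-- Existence of a limit is a Cauchy condition, which survives uniform limits by an `ε/4` argument.
Continuity and the one-sided conditions are all of this form, so closedness of every space used here
reduces to this case. -/
lemma isClosed_exists_tendsto {S J : Type*} (g : J → S) (F : Filter J) :
    IsClosed {z : LInf S | ∃ l, Tendsto (fun s => z (g s)) F (𝓝 l)} := by
  rcases F.eq_or_neBot with rfl | hF
  · simp
  refine isClosed_of_closure_subset fun z hz => ?_
  refine cauchy_map_iff_exists_tendsto.1 (Metric.cauchy_iff.2 ⟨inferInstance, fun ε hε => ?_⟩)
  obtain ⟨w, ⟨l, hw⟩, hzw⟩ := Metric.mem_closure_iff.1 hz (ε / 4) (by positivity)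
  refine ⟨(fun s => z (g s)) '' {s | dist (w (g s)) l < ε / 4},
    image_mem_map (Metric.tendsto_nhds.1 hw (ε / 4) (by positivity)), ?_⟩
  have key : ∀ s, dist (w (g s)) l < ε / 4 → |z (g s) - l| < ε / 2 := fun s hs => by
    have h1 := LInf.abs_sub_apply_le z w (g s)
    rw [← dist_eq_norm] at h1
    rw [Real.dist_eq] at hs
    linarith [abs_sub_le (z (g s)) (w (g s)) l]
  rintro _ ⟨s, hs, rfl⟩ _ ⟨t, ht, rfl⟩
  have h1 := key s hs
  have h2 := key t ht
  rw [abs_sub_comm] at h2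
  rw [Real.dist_eq]
  linarith [abs_sub_le (z (g s)) l (z (g t))]

/-- When `t ∈ s`, the filter `𝓝[s] t` contains the point filter at `t`, which forces the limit to be
`f t`. -/
lemma continuousWithinAt_iff_exists_tendsto {J : Type*} [TopologicalSpace J] {f : J → ℝ}
    {s : Set J} {t : J} (ht : t ∈ s) :
    ContinuousWithinAt f s t ↔ ∃ l, Tendsto f (𝓝[s] t) (𝓝 l) := by
  refine ⟨fun h => ⟨_, h⟩, fun ⟨l, hl⟩ => ?_⟩
  have : l = f t := tendsto_nhds_unique (hl.mono_left (pure_le_nhdsWithin ht))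
    (tendsto_pure_nhds f t)
  rwa [this] at hl

variable {S J : Type*} [TopologicalSpace J]

lemma isClosed_continuous (g : J → S) :
    IsClosed {z : LInf S | Continuous (fun s => z (g s))} := by
  have : {z : LInf S | Continuous (fun s => z (g s))} =
      ⋂ t : J, {z : LInf S | ∃ l, Tendsto (fun s => z (g s)) (𝓝 t) (𝓝 l)} := by
    ext z
    simp only [Set.mem_iInter]
    refine continuous_iff_continuousAt.trans (forall_congr' fun t => ?_)
    rw [← continuousWithinAt_univ, continuousWithinAt_iff_exists_tendsto (Set.mem_univ t),
      nhdsWithin_univ]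
    rfl
  rw [this]
  exact isClosed_iInter fun t => isClosed_exists_tendsto g _

lemma isClosed_isCadlag [Preorder J] (g : J → S) :
    IsClosed {z : LInf S | IsCadlag (fun s => z (g s))} := by
  have : {z : LInf S | IsCadlag (fun s => z (g s))} =
      ⋂ t : J, ({z : LInf S | ∃ l, Tendsto (fun s => z (g s)) (𝓝[≥] t) (𝓝 l)} ∩
        {z : LInf S | ∃ l, Tendsto (fun s => z (g s)) (𝓝[<] t) (𝓝 l)}) := by
    ext z
    simp only [Set.mem_iInter]
    refine forall_congr' fun t => ?_
    rw [continuousWithinAt_iff_exists_tendsto Set.self_mem_Ici]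
    rfl
  rw [this]
  exact isClosed_iInter fun t =>
    (isClosed_exists_tendsto g _).inter (isClosed_exists_tendsto g _)

lemma isClosed_isLeftContRightLim {a b : ℝ} (g : Set.Icc a b → S) :
    IsClosed {z : LInf S | IsLeftContRightLim (fun s => z (g s))} := by
  have : {z : LInf S | IsLeftContRightLim (fun s => z (g s))} =
      (⋂ (α : Set.Icc a b) (_ : a < α),
        {z : LInf S | ∃ l, Tendsto (fun s => z (g s)) (𝓝[≤] α) (𝓝 l)}) ∩
      ⋂ (α : Set.Icc a b) (_ : (α : ℝ) < b),
        {z : LInf S | ∃ l, Tendsto (fun s => z (g s)) (𝓝[>] α) (𝓝 l)} := by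
    ext z
    simp only [Set.mem_inter_iff, Set.mem_iInter]
    refine and_congr (forall_congr' fun α => forall_congr' fun _ => ?_) Iff.rfl
    rw [continuousWithinAt_iff_exists_tendsto Set.self_mem_Iic]
    rfl
  rw [this]
  exact (isClosed_iInter fun _ => isClosed_iInter fun _ => isClosed_exists_tendsto g _).inter
    (isClosed_iInter fun _ => isClosed_iInter fun _ => isClosed_exists_tendsto g _)

lemma isClosed_spaceCD (E : Type*) [TopologicalSpace E] (a b : ℝ) :
    IsClosed (spaceCD E a b : Set (LInf (E × Set.Icc a b))) := by
  have : (spaceCD E a b : Set (LInf (E × Set.Icc a b))) =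
      (⋂ α : Set.Icc a b, {z | Continuous (fun t : E => z (t, α))}) ∩
      ⋂ t : E, {z | IsLeftContRightLim (fun α : Set.Icc a b => z (t, α))} := by
    ext z
    simp only [Set.mem_inter_iff, Set.mem_iInter]
    rfl
  rw [this]
  exact (isClosed_iInter fun α => isClosed_continuous fun t => (t, α)).inter
    (isClosed_iInter fun t => isClosed_isLeftContRightLim fun α => (t, α))

lemma isClosed_spaceDD (J : Type*) [TopologicalSpace J] [Preorder J] (a b : ℝ) :
    IsClosed (spaceDD J a b : Set (LInf (J × Set.Icc a b))) := by
  have : (spaceDD J a b : Set (LInf (J × Set.Icc a b))) =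
      (⋂ α : Set.Icc a b, {z | IsCadlag (fun t : J => z (t, α))}) ∩
      ⋂ t : J, {z | IsLeftContRightLim (fun α : Set.Icc a b => z (t, α))} := by
    ext z
    simp only [Set.mem_inter_iff, Set.mem_iInter]
    rfl
  rw [this]
  exact (isClosed_iInter fun α => isClosed_isCadlag fun t => (t, α)).inter
    (isClosed_iInter fun t => isClosed_isLeftContRightLim fun α => (t, α))

end Spaces

/-! ### Quantiles -/

section QuantileFunction

lemma mem_lowerBounds_of_apply_lt {F : ℝ → ℝ} (hF : Monotone F) {α x : ℝ} (hx : F x < α) :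
    x ∈ lowerBounds {y | α ≤ F y} := fun _ hy =>
  (lt_of_not_ge fun hyx => (hx.trans_le hy).not_ge (hF hyx)).le

/-- The quantile function of a distribution function is left continuous with right limits. -/
lemma isLeftContRightLim_sInf {F : ℝ → ℝ} (hF : Monotone F) (h0 : ∀ α, 0 < α → ∃ x, F x < α)
    (h1 : ∀ α, α < 1 → ∃ x, α ≤ F x) {a b : ℝ} (ha : 0 < a) (hb : b < 1) :
    IsLeftContRightLim (fun α : Set.Icc a b => sInf {x | (α : ℝ) ≤ F x}) := by
  have hbdd : ∀ α : Set.Icc a b, BddBelow {x | (α : ℝ) ≤ F x} := fun α =>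
    let ⟨x, hx⟩ := h0 α (ha.trans_le α.2.1)
    ⟨x, mem_lowerBounds_of_apply_lt hF hx⟩
  have hne : ∀ α : Set.Icc a b, {x | (α : ℝ) ≤ F x}.Nonempty := fun α =>
    h1 α (α.2.2.trans_lt hb)
  have hmono : Monotone (fun α : Set.Icc a b => sInf {x | (α : ℝ) ≤ F x}) := fun α β hαβ =>
    csInf_le_csInf (hbdd α) (hne β) fun x hx => le_trans (Subtype.coe_le_coe.2 hαβ) hx
  refine ⟨fun α _ => ?_, fun α _ => ⟨_, hmono.tendsto_nhdsGT α⟩⟩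
  refine Metric.tendsto_nhds.2 fun ε hε => ?_
  set q := sInf {x | (α : ℝ) ≤ F x} with hq
  -- Strictly below the infimum `F` stays below `α`, hence below every `β` near `α`; this bounds the
  -- `β`-quantile from below, and monotonicity bounds it from above.
  have hx : F (q - ε / 2) < α := lt_of_not_ge fun h => by
    have := csInf_le (hbdd α) h
    linarith
  have hev : ∀ᶠ β : Set.Icc a b in 𝓝[≤] α, F (q - ε / 2) < β :=
    nhdsWithin_le_nhds (continuous_subtype_val.tendsto α |>.eventually (lt_mem_nhds hx))
  filter_upwards [hev, self_mem_nhdsWithin] with β hβ hβα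
  have h2 : sInf {x | (β : ℝ) ≤ F x} ≤ q := hmono hβα
  have h3 : q - ε / 2 ≤ sInf {x | (β : ℝ) ≤ F x} :=
    le_csInf (hne β) fun y hy => mem_lowerBounds_of_apply_lt hF hβ hy
  rw [Real.dist_eq, abs_lt]
  constructor <;> linarith

lemma isLeftContRightLim_quantile {E Ω₀ : Type*} [MeasurableSpace Ω₀] (P₀ : Measure Ω₀)
    [IsProbabilityMeasure P₀] {X : E → Ω₀ → ℝ} (hX : ∀ t, Measurable (X t)) {a b : ℝ}
    (ha : 0 < a) (hb : b < 1) (t : E) :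
    IsLeftContRightLim (fun α : Set.Icc a b => quantile P₀ X α t) := by
  have : IsProbabilityMeasure (P₀.map (X t)) := Measure.isProbabilityMeasure_map (hX t).aemeasurable
  have hF : distFun P₀ X t = cdf (P₀.map (X t)) := funext fun x => by
    rw [cdf_eq_real, map_measureReal_apply (hX t) measurableSet_Iic]
    rfl
  have h := isLeftContRightLim_sInf (F := distFun P₀ X t) (hF ▸ monotone_cdf _)
    (fun α hα => hF ▸ ((tendsto_cdf_atBot _).eventually (gt_mem_nhds hα)).exists)
    (fun α hα => hF ▸ (((tendsto_cdf_atTop _).eventually (lt_mem_nhds hα)).mono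
      fun _ => le_of_lt).exists) ha hb
  exact h

/-- The empirical distribution function of the data `y 0, …, y (n-1)`. -/
noncomputable def empCDF (y : ℕ → ℝ) (n : ℕ) (x : ℝ) : ℝ :=
  (n : ℝ)⁻¹ * ∑ i ∈ Finset.range n, Set.indicator (Set.Iic x) (fun _ => (1 : ℝ)) (y i)

/-- The indicators compare term by term. Two data sets and two points are allowed, to cover
monotonicity and perturbation of the data at once. -/
lemma empCDF_le_empCDF {y z : ℕ → ℝ} {n : ℕ} {u v : ℝ} (h : ∀ i < n, y i ≤ u → z i ≤ v) :
    empCDF y n u ≤ empCDF z n v := by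
  refine mul_le_mul_of_nonneg_left (Finset.sum_le_sum fun i hi => ?_) (by positivity)
  by_cases hu : y i ≤ u
  · rw [Set.indicator_of_mem (Set.mem_Iic.2 hu),
      Set.indicator_of_mem (Set.mem_Iic.2 (h i (Finset.mem_range.1 hi) hu))]
  · rw [Set.indicator_of_notMem (fun h => hu (Set.mem_Iic.1 h))]
    exact Set.indicator_nonneg (fun _ _ => zero_le_one) _

lemma monotone_empCDF (y : ℕ → ℝ) (n : ℕ) : Monotone (empCDF y n) := fun _ _ huv =>
  empCDF_le_empCDF fun _ _ h => h.trans huv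

lemma abs_le_sum_range (y : ℕ → ℝ) {n i : ℕ} (hi : i < n) :
    |y i| ≤ ∑ j ∈ Finset.range n, |y j| :=
  Finset.single_le_sum (f := fun j => |y j|) (fun _ _ => abs_nonneg _) (Finset.mem_range.2 hi)

lemma exists_empCDF_lt (y : ℕ → ℝ) (n : ℕ) {α : ℝ} (hα : 0 < α) : ∃ x, empCDF y n x < α := by
  -- This point lies strictly to the left of all the data.
  refine ⟨-(∑ j ∈ Finset.range n, |y j|) - 1, lt_of_eq_of_lt ?_ hα⟩
  rw [empCDF, Finset.sum_eq_zero, mul_zero]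
  intro i hi
  refine Set.indicator_of_notMem (fun h => ?_) _
  have h1 := abs_le_sum_range y (Finset.mem_range.1 hi)
  have h2 := Set.mem_Iic.1 h
  linarith [neg_abs_le (y i)]

lemma exists_le_empCDF (y : ℕ → ℝ) {n : ℕ} (hn : 1 ≤ n) {α : ℝ} (hα : α < 1) :
    ∃ x, α ≤ empCDF y n x := by
  refine ⟨∑ j ∈ Finset.range n, |y j|, hα.le.trans (le_of_eq ?_)⟩
  have hn0 : (n : ℝ) ≠ 0 := by exact_mod_cast (Nat.one_le_iff_ne_zero.1 hn)
  rw [empCDF, Finset.sum_congr rfl (g := fun _ => (1 : ℝ)), Finset.sum_const, Finset.card_range,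
    nsmul_eq_mul, mul_one, inv_mul_cancel₀ hn0]
  exact fun i hi => Set.indicator_of_mem
    (Set.mem_Iic.2 ((le_abs_self _).trans (abs_le_sum_range y (Finset.mem_range.1 hi)))) _

/-- If the data move by at most `δ`, then `F_y(x) ≤ F_z(x + δ)`. Applied in both directions, this
makes quantiles 1-Lipschitz in the data. -/
lemma sInf_empCDF_sub_le {y z : ℕ → ℝ} {n : ℕ} (hn : 1 ≤ n) {α δ : ℝ} (h0 : 0 < α) (h1 : α < 1)
    (h : ∀ i < n, |y i - z i| ≤ δ) :
    sInf {x | α ≤ empCDF z n x} - δ ≤ sInf {x | α ≤ empCDF y n x} := by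
  refine le_csInf (exists_le_empCDF y hn h1) fun x hx => ?_
  obtain ⟨x₀, hx₀⟩ := exists_empCDF_lt z n h0
  rw [sub_le_iff_le_add]
  refine csInf_le ⟨x₀, mem_lowerBounds_of_apply_lt (monotone_empCDF z n) hx₀⟩
    (le_trans (b := empCDF y n x) hx (empCDF_le_empCDF fun i hi hy => ?_))
  linarith [(abs_le.1 (h i hi)).1]

/-- Empirical quantiles depend continuously on the data. -/
lemma tendsto_sInf_empCDF {J : Type*} {F : Filter J} {y : J → ℕ → ℝ} {l : ℕ → ℝ} {n : ℕ}
    (hn : 1 ≤ n) {α : ℝ} (h0 : 0 < α) (h1 : α < 1)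
    (h : ∀ i, Tendsto (fun s => y s i) F (𝓝 (l i))) :
    Tendsto (fun s => sInf {x | α ≤ empCDF (y s) n x}) F
      (𝓝 (sInf {x | α ≤ empCDF l n x})) := by
  refine Metric.tendsto_nhds.2 fun ε hε => ?_
  have hev : ∀ᶠ s in F, ∀ i ∈ Finset.range n, |y s i - l i| ≤ ε / 2 :=
    (Finset.eventually_all _).2 fun i _ =>
      (Metric.tendsto_nhds.1 (h i) (ε / 2) (by positivity)).mono fun s hs => hs.le
  filter_upwards [hev] with s hs
  have hs' : ∀ i < n, |y s i - l i| ≤ ε / 2 := fun i hi => hs i (Finset.mem_range.2 hi)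
  have k1 := sInf_empCDF_sub_le hn h0 h1 hs'
  have k2 := sInf_empCDF_sub_le (y := l) (z := y s) hn h0 h1
    fun i hi => (abs_sub_comm _ _).trans_le (hs' i hi)
  rw [Real.dist_eq, abs_lt]
  constructor <;> linarith

end QuantileFunction

/-! ### Path regularity of the empirical quantile processes. -/

section Paths

variable {E Ω Ω₀ : Type*} [MeasurableSpace Ω₀] {P₀ : Measure Ω₀} {X : E → Ω₀ → ℝ}
  {Y : ℕ → E → Ω → ℝ} {a b : ℝ} {n : ℕ} {ω : Ω}

lemma isLeftContRightLim_quantileProcess [IsProbabilityMeasure P₀] (hX : ∀ t, Measurable (X t))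
    (ha : 0 < a) (hb : b < 1) (hn : 1 ≤ n) (t : E) :
    IsLeftContRightLim (fun α : Set.Icc a b => quantileProcess P₀ X Y a b n (t, α) ω) := by
  have h1 : IsLeftContRightLim (fun α : Set.Icc a b => empQuantile Y n α t ω) :=
    isLeftContRightLim_sInf (monotone_empCDF (fun i => Y i t ω) n)
      (fun _ => exists_empCDF_lt _ n) (fun _ => exists_le_empCDF _ hn) ha hb
  have h2 := (h1.add ((isLeftContRightLim_quantile P₀ hX ha hb t).smul (-1))).smul (Real.sqrt n)
  convert h2 using 1
  funext α
  simp [quantileProcess, sub_eq_add_neg]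

/-- A general filter is allowed so that one statement serves two-sided limits, right continuity and
left limits. -/
lemma tendsto_quantileProcess {F : Filter E} (ha : 0 < a) (hb : b < 1) (hn : 1 ≤ n)
    (α : Set.Icc a b) {l : ℕ → ℝ} {q : ℝ}
    (hY : ∀ j, Tendsto (fun t => Y j t ω) F (𝓝 (l j)))
    (hq : Tendsto (fun t => quantile P₀ X α t) F (𝓝 q)) :
    Tendsto (fun t => quantileProcess P₀ X Y a b n (t, α) ω) F
      (𝓝 (Real.sqrt n * (sInf {x | (α : ℝ) ≤ empCDF l n x} - q))) :=
  ((tendsto_sInf_empCDF (y := fun t i => Y i t ω) hn (ha.trans_le α.2.1) (α.2.2.trans_lt hb)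
    hY).sub hq).const_mul _

lemma continuous_quantileProcess [TopologicalSpace E] (ha : 0 < a) (hb : b < 1) (hn : 1 ≤ n)
    (α : Set.Icc a b) (hY : ∀ j, Continuous (fun t => Y j t ω))
    (hq : Continuous (fun t : E => quantile P₀ X α t)) :
    Continuous (fun t => quantileProcess P₀ X Y a b n (t, α) ω) :=
  continuous_iff_continuousAt.2 fun t => tendsto_quantileProcess ha hb hn α
    (fun j => (hY j).tendsto t) (hq.tendsto t)

lemma isCadlag_quantileProcess [TopologicalSpace E] [Preorder E] (ha : 0 < a) (hb : b < 1)
    (hn : 1 ≤ n) (α : Set.Icc a b) (hY : ∀ j, IsCadlag (fun t => Y j t ω))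
    (hq : Continuous (fun t : E => quantile P₀ X α t)) :
    IsCadlag (fun t => quantileProcess P₀ X Y a b n (t, α) ω) := fun t => by
  choose l hl using fun j => (hY j t).2
  exact ⟨tendsto_quantileProcess ha hb hn α (fun j => (hY j t).1)
    ((hq.tendsto t).mono_left nhdsWithin_le_nhds), _,
    tendsto_quantileProcess ha hb hn α hl ((hq.tendsto t).mono_left nhdsWithin_le_nhds)⟩

end Paths

/-! ### Comparison of versions through a set of parameters. -/

lemma abs_le_of_frequently {J : Type*} {f : J → ℝ} {l : Filter J} {t : J} {D : Set J} {c : ℝ}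
    (hf : Tendsto f l (𝓝 (f t))) (hD : ∃ᶠ s in l, s ∈ D) (hc : ∀ s ∈ D, |f s| ≤ c) :
    |f t| ≤ c :=
  isClosed_Iic.mem_of_frequently_of_tendsto (hD.mono fun s hs => hc s hs) hf.abs

/-- The transfer of the CLT to a subspace of functions on `E × I` whose values are limits, in the
first variable, of the values on a set `D`. -/
lemma CLTIn.of_agree_on {E I Ω Ω' : Type*} [TopologicalSpace E] [TopologicalSpace I]
    [MeasurableSpace Ω] [MeasurableSpace Ω'] {P : Measure Ω} [IsFiniteMeasure P]
    {P' : Measure Ω'} [IsProbabilityMeasure P'] {Z Z' : ℕ → E × I → Ω → ℝ}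
    {W : E × I → Ω' → ℝ} (h : CLTIn (⊤ : Submodule ℝ (LInf (E × I))) P Z P' W)
    (hd : ∀ p : E × I, Tendsto (fun q => dL2 P' W q p) (𝓝 p) (𝓝 0))
    {M : Submodule ℝ (LInf (E × I))} (hM : IsClosed (M : Set (LInf (E × I))))
    (hC : ∀ z : LInf (E × I), Continuous (z : E × I → ℝ) → z ∈ M)
    (l : E → Filter E) (D : Set E) (hD : ∀ t, ∃ᶠ s in l t, s ∈ D)
    (hMl : ∀ z ∈ M, ∀ t α, Tendsto (fun s => z (s, α)) (l t) (𝓝 (z (t, α))))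
    (hZ : ∀ n, 1 ≤ n → ∀ᵐ ω ∂P, ∀ t ∈ D, ∀ α, Z' n (t, α) ω = Z n (t, α) ω)
    (hZl : ∀ n, 1 ≤ n → ∀ᵐ ω ∂P,
      ∀ t α, Tendsto (fun s => Z' n (s, α) ω) (l t) (𝓝 (Z' n (t, α) ω)))
    (hZM : ∀ n, 1 ≤ n → ∀ᵐ ω ∂P,
      ∀ z : LInf (E × I), (z : E × I → ℝ) = (fun p => Z' n p ω) → z ∈ M) :
    CLTIn M P Z' P' W := by
  refine h.transfer hM (fun p : D × I => ((p.1 : E), p.2)) (fun z hz => ?_) (fun n hn => ?_)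
    (fun n hn => ?_) (ae_mem_of_L2_continuous h.gaussian hd hM hC)
  · refine lp.norm_le_of_forall_le (norm_nonneg _) fun p => ?_
    exact abs_le_of_frequently (f := fun s => z (s, p.2)) (hMl z hz p.1 p.2) (hD p.1) fun s hs =>
      LInf.abs_apply_le (QuantileCLT.pullback (fun p : D × I => ((p.1 : E), p.2)) z) (⟨s, hs⟩, p.2)
  · filter_upwards [hZ n hn] with ω hω p
    exact hω p.1 p.1.2 p.2
  · filter_upwards [h.mem n hn, hZ n hn, hZl n hn, hZM n hn] with ω ⟨z, hz⟩ h1 h2 h3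
    -- Boundedness of the path of `Z'` is inherited from `Z`: the bound holds on `D` and passes to
    -- the limit.
    refine exists_mem_of_abs_le (C := ‖(z : LInf (E × I))‖) (fun p => ?_) h3
    refine abs_le_of_frequently (f := fun s => Z' n (s, p.2) ω) (h2 p.1 p.2) (hD p.1)
      fun s hs => ?_
    rw [h1 s hs, ← congrFun hz (s, p.2)]
    exact LInf.abs_apply_le _ _

/-- A set which contains the top element and is dense is dense from the right. -/
lemma frequently_nhdsGE_of_dense {T : ℝ} (hT : 0 ≤ T) {D : Set (Set.Icc 0 T)} (hD : Dense D)
    (hTD : (⟨T, hT, le_rfl⟩ : Set.Icc 0 T) ∈ D) (t : Set.Icc 0 T) :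
    ∃ᶠ s in 𝓝[≥] t, s ∈ D := by
  -- At `t = T` there is nothing to the right, so density gives nothing and `T` itself must be in
  -- `D`. For `t < T`, the open set `Ioi t` accumulates at `t` and `D` is dense in it.
  rcases t.2.2.eq_or_lt with h | h
  · have ht : t ∈ D := by
      convert hTD
      exact Subtype.ext h
    exact (frequently_pure.2 ht).filter_mono (pure_le_nhdsWithin Set.self_mem_Ici)
  · have h1 : t ∈ closure (Set.Ioi t) := by
      rw [closure_Ioi' ⟨⟨T, hT, le_rfl⟩, h⟩]
      exact Set.self_mem_Ici
    have h2 : t ∈ closure (Set.Ioi t ∩ D) :=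
      closure_minimal (hD.open_subset_closure_inter isOpen_Ioi) isClosed_closure h1
    have h3 := mem_closure_iff_frequently.1 h2
    rw [nhdsWithin, frequently_inf_principal]
    exact h3.mono fun s hs => ⟨(Set.mem_Ioi.1 hs.1).le, hs.2⟩

lemma quantileProcess_congr {E Ω Ω₀ : Type*} [MeasurableSpace Ω₀] (P₀ : Measure Ω₀)
    (X : E → Ω₀ → ℝ) {Y Y' : ℕ → E → Ω → ℝ} {a b : ℝ} {n : ℕ} {t : E} {ω : Ω}
    (h : ∀ j, Y' j t ω = Y j t ω) (α : Set.Icc a b) :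
    quantileProcess P₀ X Y' a b n (t, α) ω = quantileProcess P₀ X Y a b n (t, α) ω := by
  simp only [quantileProcess, empQuantile, empDistFun, h]

end QuantileCLT

/-! ### The two cases of the theorem. -/

theorem mainTheorem10 {Ω₀ Ω Ω' : Type*} [MeasurableSpace Ω₀] [MeasurableSpace Ω]
    [MeasurableSpace Ω'] (P₀ : Measure Ω₀) [IsProbabilityMeasure P₀]
    (P : Measure Ω) [IsProbabilityMeasure P] (P' : Measure Ω') [IsProbabilityMeasure P']
    (a b : ℝ) (ha : 0 < a) (hab : a ≤ b) (hb : b < 1) :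
    -- (i) continuous paths
    (∀ (E : Type*) [MetricSpace E] (X : E → Ω₀ → ℝ) (Y : ℕ → E → Ω → ℝ)
        (W : E × Set.Icc a b → Ω' → ℝ),
      QuantileCLT.Hyp P₀ X P Y a b P' W →
      ∀ Y' : ℕ → E → Ω → ℝ, QuantileCLT.IsVersion P Y' Y →
        (∀ j, ∀ᵐ ω ∂P, Continuous (fun t => Y' j t ω)) →
        (TopologicalSpace.SeparableSpace E ∨
          QuantileCLT.CLTIn (⊤ : Submodule ℝ (QuantileCLT.LInf (E × Set.Icc a b))) P
            (QuantileCLT.quantileProcess P₀ X Y' a b) P' W) →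
        IsClosed (QuantileCLT.spaceCD E a b : Set (QuantileCLT.LInf (E × Set.Icc a b))) ∧
        QuantileCLT.CLTIn (QuantileCLT.spaceCD E a b) P
          (QuantileCLT.quantileProcess P₀ X Y' a b) P' W ∧
        ∀ α : Set.Icc a b,
          QuantileCLT.CLTIn (QuantileCLT.spaceC E) P
            (fun n t ω => QuantileCLT.quantileProcess P₀ X Y' a b n (t, α) ω) P'
            (fun t => W (t, α))) ∧
    -- (ii) cadlag paths on `[0,T]`
    (∀ (T : ℝ), 0 ≤ T → ∀ (X : Set.Icc 0 T → Ω₀ → ℝ) (Y : ℕ → Set.Icc 0 T → Ω → ℝ)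
        (W : Set.Icc 0 T × Set.Icc a b → Ω' → ℝ),
      QuantileCLT.Hyp P₀ X P Y a b P' W →
      ∀ Y' : ℕ → Set.Icc 0 T → Ω → ℝ, QuantileCLT.IsVersion P Y' Y →
        (∀ j, ∀ᵐ ω ∂P, QuantileCLT.IsCadlag (fun t => Y' j t ω)) →
        IsClosed (QuantileCLT.spaceDD (Set.Icc 0 T) a b :
          Set (QuantileCLT.LInf (Set.Icc 0 T × Set.Icc a b))) ∧
        QuantileCLT.CLTIn (QuantileCLT.spaceDD (Set.Icc 0 T) a b) P
          (QuantileCLT.quantileProcess P₀ X Y' a b) P' W ∧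
        ∀ α : Set.Icc a b,
          QuantileCLT.CLTIn (QuantileCLT.spaceD (Set.Icc 0 T)) P
            (fun n t ω => QuantileCLT.quantileProcess P₀ X Y' a b n (t, α) ω) P'
            (fun t => W (t, α))) := by
  refine ⟨fun E _ X Y W H Y' hY' hcont hor => ?_, fun T hT X Y W H Y' hY' hcad => ?_⟩
  · have hX := H.copies.measurable_input
    have hcl := QuantileCLT.isClosed_spaceCD E a b
    have hC : ∀ z : QuantileCLT.LInf (E × Set.Icc a b), Continuous (z : E × Set.Icc a b → ℝ) →
        z ∈ QuantileCLT.spaceCD E a b := fun z hz =>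
      ⟨fun α => hz.comp (by fun_prop),
        fun t => ⟨fun α _ => (hz.comp (by fun_prop : Continuous fun α => (t, α))).continuousWithinAt,
          fun α _ => ⟨_, ((hz.comp (by fun_prop : Continuous fun α => (t, α))).tendsto α).mono_left
            nhdsWithin_le_nhds⟩⟩⟩
    have hpath : ∀ n, 1 ≤ n → ∀ᵐ ω ∂P, ∀ α : Set.Icc a b,
        Continuous fun t => QuantileCLT.quantileProcess P₀ X Y' a b n (t, α) ω := fun n hn => by
      filter_upwards [ae_all_iff.2 hcont] with ω hω α
      exact QuantileCLT.continuous_quantileProcess ha hb hn α hω (H.quantile_continuous α α.2)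
    have hmem : ∀ n, 1 ≤ n → ∀ᵐ ω ∂P, ∀ z : QuantileCLT.LInf (E × Set.Icc a b),
        (z : E × Set.Icc a b → ℝ) = (fun p => QuantileCLT.quantileProcess P₀ X Y' a b n p ω) →
        z ∈ QuantileCLT.spaceCD E a b := fun n hn => by
      filter_upwards [hpath n hn] with ω hω z hz
      refine ⟨fun α => ?_, fun t => ?_⟩
      · rw [hz]
        exact hω α
      · rw [hz]
        exact QuantileCLT.isLeftContRightLim_quantileProcess hX ha hb hn t
    have hclt : QuantileCLT.CLTIn (QuantileCLT.spaceCD E a b) P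
        (QuantileCLT.quantileProcess P₀ X Y' a b) P' W := by
      -- Both alternatives are instances: `Z = Y` with `D` countable and dense if `E` is separable,
      -- and `Z = Y'` with `D` all of `E` if the `W_n'` already satisfy the CLT.
      have key : ∀ (Z : ℕ → E → Ω → ℝ) (D : Set E),
          QuantileCLT.CLTIn (⊤ : Submodule ℝ (QuantileCLT.LInf (E × Set.Icc a b))) P
            (QuantileCLT.quantileProcess P₀ X Z a b) P' W → Dense D →
          (∀ᵐ ω ∂P, ∀ t ∈ D, ∀ j, Y' j t ω = Z j t ω) →
          QuantileCLT.CLTIn (QuantileCLT.spaceCD E a b) P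
            (QuantileCLT.quantileProcess P₀ X Y' a b) P' W := fun Z D hZ hD hag => by
        refine hZ.of_agree_on H.id_continuous hcl hC 𝓝 D
          (fun t => mem_closure_iff_frequently.1 (hD t)) (fun z hz t α => (hz.1 α).tendsto t)
          (fun n _ => ?_) (fun n hn => ?_) hmem
        · filter_upwards [hag] with ω hω t ht α
          exact QuantileCLT.quantileProcess_congr P₀ X (hω t ht) α
        · filter_upwards [hpath n hn] with ω hω t α
          exact (hω α).tendsto t
      rcases hor with hsep | hclt
      · obtain ⟨D, hDc, hD⟩ := TopologicalSpace.exists_countable_dense E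
        exact key Y D H.clt hD ((ae_ball_iff hDc).2 fun t _ => ae_all_iff.2 fun j => hY' j t)
      · exact key Y' Set.univ hclt dense_univ (ae_of_all _ fun _ _ _ _ => rfl)
    exact ⟨hcl, hclt, fun α => hclt.pullback (fun t => (t, α)) fun z hz => hz.1 α⟩
  · have hX := H.copies.measurable_input
    have hcl := QuantileCLT.isClosed_spaceDD (Set.Icc 0 T) a b
    have hC : ∀ z : QuantileCLT.LInf (Set.Icc 0 T × Set.Icc a b),
        Continuous (z : Set.Icc 0 T × Set.Icc a b → ℝ) →
        z ∈ QuantileCLT.spaceDD (Set.Icc 0 T) a b := fun z hz =>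
      ⟨fun α t => ⟨(hz.comp (by fun_prop : Continuous fun t => (t, α))).continuousWithinAt,
          _, ((hz.comp (by fun_prop : Continuous fun t => (t, α))).tendsto t).mono_left
            nhdsWithin_le_nhds⟩,
        fun t => ⟨fun α _ => (hz.comp (by fun_prop : Continuous fun α => (t, α))).continuousWithinAt,
          fun α _ => ⟨_, ((hz.comp (by fun_prop : Continuous fun α => (t, α))).tendsto α).mono_left
            nhdsWithin_le_nhds⟩⟩⟩
    have hpath : ∀ n, 1 ≤ n → ∀ᵐ ω ∂P, ∀ α : Set.Icc a b, QuantileCLT.IsCadlag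
        fun t => QuantileCLT.quantileProcess P₀ X Y' a b n (t, α) ω := fun n hn => by
      filter_upwards [ae_all_iff.2 hcad] with ω hω α
      exact QuantileCLT.isCadlag_quantileProcess ha hb hn α hω (H.quantile_continuous α α.2)
    obtain ⟨D, hDc, hD⟩ := TopologicalSpace.exists_countable_dense (Set.Icc 0 T)
    -- The end point `T` is added because right limits cannot recover the value there; the set stays
    -- countable, so one null set suffices.
    have hag : ∀ᵐ ω ∂P, ∀ t ∈ insert (⟨T, hT, le_rfl⟩ : Set.Icc 0 T) D,
        ∀ j, Y' j t ω = Y j t ω :=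
      (ae_ball_iff (hDc.insert _)).2 fun t _ => ae_all_iff.2 fun j => hY' j t
    have hclt : QuantileCLT.CLTIn (QuantileCLT.spaceDD (Set.Icc 0 T) a b) P
        (QuantileCLT.quantileProcess P₀ X Y' a b) P' W := by
      refine H.clt.of_agree_on H.id_continuous hcl hC (fun t => 𝓝[≥] t) _
        (QuantileCLT.frequently_nhdsGE_of_dense hT (hD.mono (Set.subset_insert _ _))
          (Set.mem_insert _ _))
        (fun z hz t α => (hz.1 α t).1) (fun n _ => ?_) (fun n hn => ?_) (fun n hn => ?_)
      · filter_upwards [hag] with ω hω t ht α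
        exact QuantileCLT.quantileProcess_congr P₀ X (hω t ht) α
      · filter_upwards [hpath n hn] with ω hω t α
        exact (hω α t).1
      · filter_upwards [hpath n hn] with ω hω z hz
        refine ⟨fun α => ?_, fun t => ?_⟩
        · rw [hz]
          exact hω α
        · rw [hz]
          exact QuantileCLT.isLeftContRightLim_quantileProcess hX ha hb hn t
    exact ⟨hcl, hclt, fun α => hclt.pullback (fun t => (t, α)) fun z hz => hz.1 α⟩
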